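/- For each $n\ge 1$ let $G=G_n$ be a connected graph with vertex set $\{1,\dots,n\}$ and edge set $E$, let $t=t_n>0$, and let $\theta_0\in\mathbb{R}^n$ (depending on $n$) satisfy $$\theta_0\in \mathrm{BV}_G(t)=\Big\{\theta\in\mathbb{R}^n:\ \sum_{\{u,v\}\in E}|\theta_u-\theta_v|\le t\Big\}.$$ Assume that $n^{-1/2}=O(t_n)$ (for instance, that $t$ is constant). We observe $y_i=\theta_{0,i}+\epsilon_i$, $i=1,\dots,n$, where, for each $n$, the errors $\epsilon_1,\dots,\epsilon_n$ are i.i.d. with $\mathbb{E}(\epsilon_i)=0$ and $\mathbb{P}(|\epsilon_i|>s)\le M\exp(-s^2/(2\sigma^2))$ for all $s\ge 0$, with constants $M,\sigma>0$ that do not depend on $n$. Let $\tau(1),\dots,\tau(n)$ be the vertices of $G$ in the order in which they are first reached by a depth-first search on $G$; the root, and the choice of the next unvisited neighbour at each step, are arbitrary. Let $(Py)_i=y_{\tau(i)}$ be the associated permutation. For $\lambda\ge 0$ the DFS fused lasso estimator is $$\hat\theta_{\mathrm{DFS}}=P^{\top}\Big(\mathop{\mathrm{argmin}}_{\theta\in\mathbb{R}^n}\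 \tfrac12\|Py-\theta\|_2^2+\lambda\sum_{i=1}^{n-1}|\theta_{i+1}-\theta_i|\Big).$$ Then, for any such DFS orderings and any choice $\lambda=\lambda_n\asymp t^{-1/3}n^{1/3}$, as $n\to\infty$, $$\frac1n\|\hat\theta_{\mathrm{DFS}}-\theta_0\|_2^2=O_{\mathbb{P}}\big(t^{2/3}n^{-2/3}\big),$$ that is, for every $\delta>0$ there is $C>0$ such that, for all sufficiently large $n$, $\mathbb{P}\big(\tfrac1n\|\hat\theta_{\mathrm{DFS}}-\theta_0\|_2^2> C\,t^{2/3}n^{-2/3}\big)\le\delta$. -/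

import Mathlib

open Filter Asymptotics MeasureTheory ProbabilityTheory
open scoped NNReal

/-- The total variation `∑_{e ∈ E} |θ_{e⁺} - θ_{e⁻}|` of a signal `θ` over the edges of `G`
(each edge is counted once; its orientation does not matter). -/
noncomputable def graphTV {n : ℕ} (G : SimpleGraph (Fin n)) (θ : Fin n → ℝ) : ℝ :=
  open Classical in
  ∑ e ∈ G.edgeFinset, Sym2.lift ⟨fun u v => |θ u - θ v|, fun u v => abs_sub_comm (θ u) (θ v)⟩ e

/-- The bounded variation class of radius `t` over the graph `G`. -/
def BVClass {n : ℕ} (G : SimpleGraph (Fin n)) (t : ℝ) : Set (Fin n → ℝ) :=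
  {θ | graphTV G θ ≤ t}

/-- The total variation `∑_{i=1}^{n-1} |x_{i+1} - x_i|` over the chain with `n` nodes. -/
def chainTV {n : ℕ} (x : Fin n → ℝ) : ℝ :=
  ∑ i : Fin (n - 1), |x ⟨i + 1, by omega⟩ - x ⟨i, by omega⟩|

/-- The configurations that a run of depth-first search on `G` from the root `s` can reach.
`DFSReach G s S L` says that at some moment of some run the stack is `S` (top first) and the
nodes reached so far are `L`, in the order in which they were reached. Whenever the node on top
of the stack has unvisited neighbours, an arbitrary one of them is visited next; when it has
none, the search backtracks. -/
inductive DFSReach {V : Type*} (G : SimpleGraph V) (s : V) : List V → List V → Prop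
  | start : DFSReach G s [s] [s]
  | visit {u w : V} {S L : List V} (h : DFSReach G s (u :: S) L)
      (hadj : G.Adj u w) (hw : w ∉ L) : DFSReach G s (w :: u :: S) (L ++ [w])
  | backtrack {u : V} {S L : List V} (h : DFSReach G s (u :: S) L)
      (hu : ∀ w, G.Adj u w → w ∈ L) : DFSReach G s S L

/-- `τ` is a DFS ordering of `G`: some complete run of depth-first search (one that ends with an
empty stack) reaches the nodes in the order `τ 0, τ 1, …, τ (n - 1)`. -/
def IsDFSOrdering {n : ℕ} (G : SimpleGraph (Fin n)) (τ : Equiv.Perm (Fin n)) : Prop :=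
  ∃ s, DFSReach G s [] (List.ofFn τ)

/-- The criterion minimized by the 1d fused lasso. -/
noncomputable def fusedLassoObjective {n : ℕ} (lam : ℝ≥0) (y θ : Fin n → ℝ) : ℝ :=
  1 / 2 * ∑ i, (y i - θ i) ^ 2 + lam * chainTV θ

/-- The 1d fused lasso criterion has exactly one minimizer. -/
theorem existsUnique_fusedLasso {n : ℕ} (lam : ℝ≥0) (y : Fin n → ℝ) :
    ∃! θ : Fin n → ℝ, ∀ θ', fusedLassoObjective lam y θ ≤ fusedLassoObjective lam y θ' := by
  have tv_nonneg : ∀ x : Fin n → ℝ, 0 ≤ chainTV x := fun x =>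
    Finset.sum_nonneg fun i _ => abs_nonneg _
  have hcont : Continuous (fusedLassoObjective lam y) := by
    unfold fusedLassoObjective chainTV
    fun_prop
  have hex : ∃ θ : Fin n → ℝ, ∀ θ',
      fusedLassoObjective lam y θ ≤ fusedLassoObjective lam y θ' := by
    refine hcont.exists_forall_le' y ?_
    set K := fusedLassoObjective lam y y with hK
    have hKn : 0 ≤ K := by
      have := mul_nonneg lam.coe_nonneg (tv_nonneg y)
      simpa [hK, fusedLassoObjective] using this
    filter_upwards [(isCompact_closedBall y (2 * K + 1)).compl_mem_cocompact] with θ hθ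
    have hd : 2 * K + 1 < ‖y - θ‖ := by
      rw [← dist_eq_norm, dist_comm]
      simpa using hθ
    obtain ⟨i, hi⟩ : ∃ i, 2 * K + 1 < |y i - θ i| := by
      by_contra! hcon
      have : ‖y - θ‖ ≤ 2 * K + 1 :=
        (pi_norm_le_iff_of_nonneg (by linarith)).2 fun i => by
          simpa [Real.norm_eq_abs] using hcon i
      linarith
    have h1 : (y i - θ i) ^ 2 ≤ ∑ j, (y j - θ j) ^ 2 :=
      Finset.single_le_sum (f := fun j => (y j - θ j) ^ 2) (fun j _ => sq_nonneg _)
        (Finset.mem_univ i)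
    have h2 : 2 * K ≤ (y i - θ i) ^ 2 := by
      rw [← sq_abs]
      nlinarith
    have h3 := mul_nonneg lam.coe_nonneg (tv_nonneg θ)
    unfold fusedLassoObjective
    linarith
  obtain ⟨a, ha⟩ := hex
  refine ⟨a, ha, fun b hb => ?_⟩
  have hm := ha (fun i => (a i + b i) / 2)
  have hab : fusedLassoObjective lam y b ≤ fusedLassoObjective lam y a := hb a
  have htv : chainTV (fun i => (a i + b i) / 2) ≤ (chainTV a + chainTV b) / 2 := by
    unfold chainTV
    rw [← Finset.sum_add_distrib, Finset.sum_div]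
    refine Finset.sum_le_sum fun i _ => ?_
    rw [← sub_div, abs_div, abs_two, add_sub_add_comm]
    gcongr
    exact abs_add_le _ _
  have hsq : ∑ i, (y i - (a i + b i) / 2) ^ 2 = 1 / 2 * ∑ i, (y i - a i) ^ 2
      + 1 / 2 * ∑ i, (y i - b i) ^ 2 - 1 / 4 * ∑ i, (b i - a i) ^ 2 := by
    simp only [Finset.mul_sum]
    rw [← Finset.sum_add_distrib, ← Finset.sum_sub_distrib]
    exact Finset.sum_congr rfl fun i _ => by ring
  have htv' := mul_le_mul_of_nonneg_left htv lam.coe_nonneg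
  unfold fusedLassoObjective at hm hab
  rw [hsq] at hm
  have h0 : ∑ i, (b i - a i) ^ 2 ≤ 0 := by linarith
  have h0' := (Finset.sum_eq_zero_iff_of_nonneg fun i _ => sq_nonneg (b i - a i)).1
    (le_antisymm h0 (Finset.sum_nonneg fun i _ => sq_nonneg _))
  funext i
  have := pow_eq_zero_iff (two_ne_zero) |>.1 (h0' i (Finset.mem_univ i))
  linarith

/-- The 1d fused lasso estimate for the data `y`: the minimizer of the criterion. -/
noncomputable def fusedLasso {n : ℕ} (lam : ℝ≥0) (y : Fin n → ℝ) : Fin n → ℝ :=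
  (existsUnique_fusedLasso lam y).choose

/-- The DFS fused lasso estimate for the ordering `τ`: the 1d fused lasso applied to the permuted
data `(P y)_i = y_{τ(i)}`, with the inverse permutation applied to the result. -/
noncomputable def dfsFusedLasso {n : ℕ} (lam : ℝ≥0) (τ : Equiv.Perm (Fin n)) (y : Fin n → ℝ) :
    Fin n → ℝ :=
  fun v => fusedLasso lam (fun i => y (τ i)) (τ.symm v)

/-- The mean squared error `‖x - θ‖_n² = n⁻¹ ‖x - θ‖₂²`. -/
noncomputable def mse {n : ℕ} (x θ : Fin n → ℝ) : ℝ :=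
  1 / (n : ℝ) * ∑ i, (x i - θ i) ^ 2

/-- The errors `ε_1, …, ε_n` are i.i.d., have mean zero and are sub-Gaussian with constants
`M` and `σ`. -/
structure IsSubGaussianNoise {Ω : Type*} [MeasurableSpace Ω] (μ : Measure Ω) {n : ℕ}
    (ε : Fin n → Ω → ℝ) (M σ : ℝ) : Prop where
  measurable : ∀ i, Measurable (ε i)
  indep : iIndepFun ε μ
  identDistrib : ∀ i j, IdentDistrib (ε i) (ε j) μ μ
  mean_zero : ∀ i, ∫ ω, ε i ω ∂μ = 0
  tail : ∀ i, ∀ s : ℝ, 0 ≤ s → μ.real {ω | s < |ε i ω|} ≤ M * Real.exp (-s ^ 2 / (2 * σ ^ 2))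

/-- `A_n = O_ℙ(b_n)`: the sequence `A_n / b_n` is bounded in probability. The random variables
`A_n` may live on different probability spaces. -/
def IsBigOInProbability {Ω : ℕ → Type*} [∀ n, MeasurableSpace (Ω n)] (μ : ∀ n, Measure (Ω n))
    (A : ∀ n, Ω n → ℝ) (b : ℕ → ℝ) : Prop :=
  ∀ δ : ℝ, 0 < δ → ∃ C : ℝ, 0 < C ∧
    ∀ᶠ n in atTop, (μ n).real {ω | C * |b n| < |A n ω|} ≤ δ

/-! A depth-first search walks along each edge of its tree once down and once back. By the triangle
inequality the DFS order therefore has total variation at most twice that of the graph, so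
`IsDFSOrdering.chainTV_le` leaves a fused lasso on a chain, with signal variation at most `2t` and
noise whose law has the same properties after the permutation.

On the chain, optimality bounds half the squared error by the inner product of the noise `e` with
the error `d`, plus `lam` times the variation of the signal minus that of the estimate. The inner
product is expanded in the Haar basis down to blocks of length `2 ^ K`, with `2 ^ K` of order `lam ^
2` (when `lam` is not small). The Haar coefficients of `d` at level `k` have absolute sum at most
`√2 ^ (k + 1)` times the variation of `d`. Noise coefficients are truncated at `K - k`: the
truncated part costs at most `lam / 2` times the variation of the zero extension of `d`, which the
penalty absorbs, since the weights `(K - k) * √2 ^ (k + 1)` sum to order `√2 ^ K`. The excess and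
the coarse part form `residualEnergy`, and Cauchy-Schwarz trades them against a fraction of the
squared error (`sum_sq_fusedLasso_sub_le`).

The linear growth of the threshold avoids a logarithm: going one level down doubles the number of
blocks but multiplies the bound on the mean excess energy by `1 / e`, so the levels sum
geometrically and the mean residual is of order `n / lam ^ 2 + 1`
(`IsSubGaussianNoise.integral_residualEnergy_le`). Markov's inequality finishes: for `lam` of order
`t ^ (-1/3) * n ^ (1/3)`, both `lam * t` and `n / lam ^ 2` have order `t ^ (2/3) * n ^ (1/3)`, and
the lower bound on `t` makes the remaining terms no larger. -/

/-! ### Depth-first search at most doubles the total variation -/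

/-- The total variation of `θ` along the consecutive entries of a list. -/
def pathTV {V : Type*} (θ : V → ℝ) : List V → ℝ
  | [] => 0
  | [_] => 0
  | a :: b :: l => |θ a - θ b| + pathTV θ (b :: l)

theorem pathTV_append_pair {V : Type*} (θ : V → ℝ) (L : List V) (a b : V) :
    pathTV θ (L ++ [a, b]) = pathTV θ (L ++ [a]) + |θ a - θ b| := by
  induction L with
  | nil => simp [pathTV]
  | cons c L ih =>
    cases L with
    | nil => simp [pathTV]
    | cons d L =>
      simp only [List.cons_append, pathTV] at ih ⊢
      rw [ih, add_assoc]

theorem pathTV_nonneg {V : Type*} (θ : V → ℝ) (L : List V) : 0 ≤ pathTV θ L := by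
  induction L with
  | nil => simp [pathTV]
  | cons c L ih =>
    cases L with
    | nil => simp [pathTV]
    | cons d L => exact add_nonneg (abs_nonneg _) ih

theorem pathTV_ofFn {V : Type*} (θ : V → ℝ) {n : ℕ} (f : Fin n → V) :
    pathTV θ (List.ofFn f) = chainTV fun i => θ (f i) := by
  induction n with
  | zero => simp [pathTV, chainTV]
  | succ n ih =>
    cases n with
    | zero => simp [pathTV, chainTV]
    | succ n =>
      have h := ih fun i => f i.succ
      rw [List.ofFn_succ, List.ofFn_succ]
      rw [List.ofFn_succ] at h
      simp only [pathTV]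
      rw [h]
      simp only [chainTV]
      refine Eq.trans ?_ (Fin.sum_univ_succ fun i : Fin (n + 1) =>
        |θ (f ⟨i + 1, by omega⟩) - θ (f ⟨i, by omega⟩)|).symm
      rw [abs_sub_comm]
      rfl

/-- The jump of `θ` along an edge. -/
def edgeJump {V : Type*} (θ : V → ℝ) (e : Sym2 V) : ℝ :=
  Sym2.lift ⟨fun u v => |θ u - θ v|, fun u v => abs_sub_comm (θ u) (θ v)⟩ e

theorem edgeJump_nonneg {V : Type*} (θ : V → ℝ) (e : Sym2 V) : 0 ≤ edgeJump θ e := by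
  induction e with
  | _ u v => exact abs_nonneg _

/-- Along any run of depth-first search, the path through the visited nodes, continued to the top
of the stack and back down to the root, is at most twice as long as a set of visited edges. -/
theorem DFSReach.exists_edges {V : Type*} {G : SimpleGraph V} {s : V} (θ : V → ℝ)
    {S L : List V} (h : DFSReach G s S L) :
    ∃ (F : Finset (Sym2 V)) (L' : List V) (l : V),
      (∀ e ∈ F, e ∈ G.edgeSet ∧ ∀ v ∈ e, v ∈ L) ∧ L = L' ++ [l] ∧ (∀ v ∈ S, v ∈ L) ∧
      (∀ u S', S = u :: S' →
        pathTV θ L + |θ l - θ u| + pathTV θ S ≤ 2 * ∑ e ∈ F, edgeJump θ e) ∧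
      pathTV θ L ≤ 2 * ∑ e ∈ F, edgeJump θ e := by
  classical
  -- A visited edge brings credit for two traversals: one is spent on reaching the new node, the
  -- other stays in the stack term until the search backtracks. The claim about the top of the stack
  -- is void once the stack is empty, so the bound on the path alone is carried separately.
  induction h with
  | start => exact ⟨∅, [], s, by simp, rfl, by simp, by simp [pathTV], by simp [pathTV]⟩
  | @visit u w S L h hadj hw ih =>
    obtain ⟨F, L', l, hF, rfl, hS, hTV, -⟩ := ih
    -- The edge has not been counted before, because `w` is new.
    have hnot : s(u, w) ∉ F := fun hmem => hw ((hF _ hmem).2 w (by simp))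
    have h0 := hTV u S rfl
    have hp : pathTV θ (L' ++ [l] ++ [w]) = pathTV θ (L' ++ [l]) + |θ l - θ w| := by
      rw [← pathTV_append_pair]; simp
    have hle : pathTV θ (L' ++ [l] ++ [w]) + pathTV θ (w :: u :: S)
        ≤ 2 * ∑ e ∈ insert s(u, w) F, edgeJump θ e := by
      rw [Finset.sum_insert hnot, hp]
      have h1 := abs_sub_le (θ l) (θ u) (θ w)
      have h2 := abs_sub_comm (θ u) (θ w)
      simp only [edgeJump, Sym2.lift_mk, pathTV] at h0 ⊢
      linarith
    refine ⟨insert s(u, w) F, L' ++ [l], w, ?_, rfl, ?_, ?_, ?_⟩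
    · intro e he
      rcases Finset.mem_insert.1 he with rfl | he
      · refine ⟨hadj, fun v hv => ?_⟩
        rcases Sym2.mem_iff.1 hv with rfl | rfl
        · exact List.mem_append_left _ (hS _ (by simp))
        · simp
      · exact ⟨(hF e he).1, fun v hv => List.mem_append_left _ ((hF e he).2 v hv)⟩
    · intro v hv
      rcases List.mem_cons.1 hv with rfl | hv
      · simp
      · exact List.mem_append_left _ (hS v hv)
    · rintro u' S' ⟨⟩
      simpa using hle
    · linarith [pathTV_nonneg θ (w :: u :: S)]
  | @backtrack u S L h hu ih =>
    obtain ⟨F, L', l, hF, hL, hS, hTV, hTV'⟩ := ih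
    refine ⟨F, L', l, hF, hL, fun v hv => hS v (List.mem_cons_of_mem _ hv), ?_, hTV'⟩
    rintro v S' rfl
    have h0 := hTV u _ rfl
    simp only [pathTV] at h0 ⊢
    linarith [abs_sub_le (θ l) (θ u) (θ v)]

theorem IsDFSOrdering.chainTV_le {n : ℕ} {G : SimpleGraph (Fin n)} {τ : Equiv.Perm (Fin n)}
    (h : IsDFSOrdering G τ) (θ : Fin n → ℝ) :
    chainTV (fun i => θ (τ i)) ≤ 2 * graphTV G θ := by
  classical
  obtain ⟨s, hs⟩ := h
  obtain ⟨F, -, -, hF, -, -, -, hTV⟩ := hs.exists_edges θ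
  rw [← pathTV_ofFn]
  refine hTV.trans (mul_le_mul_of_nonneg_left ?_ zero_le_two)
  exact Finset.sum_le_sum_of_subset_of_nonneg (fun e he => by simpa using (hF e he).1)
    fun e _ _ => edgeJump_nonneg θ e

/-! ### The Haar expansion and the deterministic error bound -/

/-- The scaling coefficient of a sequence on the `b`-th dyadic block of length `2 ^ k`. -/
noncomputable def scalingCoeff (x : ℕ → ℝ) : ℕ → ℕ → ℝ
  | 0, b => x b
  | k + 1, b => (scalingCoeff x k (2 * b) + scalingCoeff x k (2 * b + 1)) / √2

/-- The Haar coefficient of a sequence on the `b`-th dyadic block of length `2 ^ (k + 1)`. -/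
noncomputable def haarCoeff (x : ℕ → ℝ) (k b : ℕ) : ℝ :=
  (scalingCoeff x k (2 * b) - scalingCoeff x k (2 * b + 1)) / √2

/-- Sum and difference divided by `√2` form an orthogonal change of coordinates on each pair of
neighbouring blocks. -/
theorem scalingCoeff_mul_add_mul (x y : ℕ → ℝ) (k b : ℕ) :
    scalingCoeff x k (2 * b) * scalingCoeff y k (2 * b)
      + scalingCoeff x k (2 * b + 1) * scalingCoeff y k (2 * b + 1)
    = scalingCoeff x (k + 1) b * scalingCoeff y (k + 1) b + haarCoeff x k b * haarCoeff y k b := by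
  have h2 : √(2 : ℝ) * √2 = 2 := Real.mul_self_sqrt (by norm_num)
  simp only [haarCoeff, scalingCoeff, div_mul_div_comm, h2]
  ring

/-- A scaling coefficient is the block sum divided by `√2 ^ k`, so a constant `z` has coefficient
`√2 ^ k * z`. The case `z = T = 0` gives the vanishing beyond the support. -/
theorem abs_scalingCoeff_sub_le {x : ℕ → ℝ} {z T : ℝ} (k : ℕ) :
    ∀ b, (∀ i, b * 2 ^ k ≤ i → i < (b + 1) * 2 ^ k → |x i - z| ≤ T) →
      |scalingCoeff x k b - √2 ^ k * z| ≤ √2 ^ k * T := by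
  have hs : 0 < √(2 : ℝ) := by positivity
  have h2 : √(2 : ℝ) * √2 = 2 := Real.mul_self_sqrt (by norm_num)
  induction k with
  | zero => intro b h; simpa [scalingCoeff] using h b (by simp) (by simp)
  | succ k ih =>
    intro b h
    have hA := ih (2 * b) fun i h1 h2 => h i (by rw [pow_succ]; linarith)
      (by rw [pow_succ]; nlinarith [Nat.one_le_two_pow (n := k)])
    have hB := ih (2 * b + 1) fun i h1 h2 => h i
      (by rw [pow_succ]; nlinarith [Nat.one_le_two_pow (n := k)]) (by rw [pow_succ]; linarith)
    have e : scalingCoeff x (k + 1) b - √2 ^ (k + 1) * z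
        = ((scalingCoeff x k (2 * b) - √2 ^ k * z)
          + (scalingCoeff x k (2 * b + 1) - √2 ^ k * z)) / √2 := by
      rw [eq_div_iff hs.ne', scalingCoeff, sub_mul, div_mul_cancel₀ _ hs.ne', pow_succ]
      linear_combination (-(√2 ^ k) * z) * h2
    rw [e, abs_div, abs_of_pos hs, div_le_iff₀ hs]
    refine (abs_add_le _ _).trans ?_
    rw [pow_succ]
    linear_combination hA + hB - (√2 ^ k) * T * h2

theorem scalingCoeff_eq_zero {x : ℕ → ℝ} {n k b : ℕ} (hx : ∀ i, n ≤ i → x i = 0)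
    (hb : n ≤ b * 2 ^ k) : scalingCoeff x k b = 0 := by
  have := abs_scalingCoeff_sub_le (x := x) (z := 0) (T := 0) k b fun i hi _ => by
    simp [hx i (hb.trans hi)]
  simpa using this

theorem haarCoeff_eq_zero {x : ℕ → ℝ} {n k b : ℕ} (hx : ∀ i, n ≤ i → x i = 0)
    (hb : n ≤ b * 2 ^ k) : haarCoeff x k b = 0 := by
  rw [haarCoeff, scalingCoeff_eq_zero hx (by nlinarith [Nat.one_le_two_pow (n := k)]),
    scalingCoeff_eq_zero hx (by nlinarith [Nat.one_le_two_pow (n := k)])]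
  simp

theorem sum_range_two_mul (f : ℕ → ℝ) (n : ℕ) :
    ∑ i ∈ Finset.range (2 * n), f i = ∑ i ∈ Finset.range n, (f (2 * i) + f (2 * i + 1)) := by
  induction n with
  | zero => simp
  | succ n ih =>
    rw [show 2 * (n + 1) = 2 * n + 1 + 1 by ring, Finset.sum_range_succ, Finset.sum_range_succ, ih,
      Finset.sum_range_succ]
    ring

/-- The Haar expansion of an inner product down to the dyadic level `K`. -/
theorem sum_mul_eq_haar {x : ℕ → ℝ} {n : ℕ} (hx : ∀ i, n ≤ i → x i = 0) (y : ℕ → ℝ) (K : ℕ) :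
    ∑ i ∈ Finset.range n, x i * y i
      = ∑ b ∈ Finset.range n, scalingCoeff x K b * scalingCoeff y K b
        + ∑ k ∈ Finset.range K, ∑ b ∈ Finset.range n, haarCoeff x k b * haarCoeff y k b := by
  induction K with
  | zero => simp [scalingCoeff]
  | succ K ih =>
    -- The range is doubled so that the blocks pair up; the added blocks lie beyond the support of
    -- `x`.
    have h : ∑ b ∈ Finset.range n, scalingCoeff x K b * scalingCoeff y K b
        = ∑ b ∈ Finset.range (2 * n), scalingCoeff x K b * scalingCoeff y K b := by
      refine Finset.sum_subset (fun i hi => ?_) fun i _ hi => ?_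
      · simp only [Finset.mem_range] at hi ⊢; omega
      · simp only [Finset.mem_range, not_lt] at hi
        rw [scalingCoeff_eq_zero hx (by nlinarith [Nat.one_le_two_pow (n := K)]), zero_mul]
    rw [ih, h, sum_range_two_mul, Finset.sum_range_succ]
    simp only [scalingCoeff_mul_add_mul, Finset.sum_add_distrib]
    ring

theorem abs_sub_le_sum_Ico (x : ℕ → ℝ) {i j : ℕ} (h : i ≤ j) :
    |x j - x i| ≤ ∑ l ∈ Finset.Ico i j, |x (l + 1) - x l| := by
  have := dist_le_Ico_sum_dist x h
  simp only [Real.dist_eq] at this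
  rw [abs_sub_comm]
  exact this.trans_eq (Finset.sum_congr rfl fun l _ => abs_sub_comm _ _)

/-- Both half blocks are compared with the first entry of the block. The sum includes the jump into
the next block, so that the index intervals of consecutive blocks tile the line. -/
theorem abs_haarCoeff_le (x : ℕ → ℝ) (k b : ℕ) :
    |haarCoeff x k b| ≤ √2 ^ (k + 1)
      * ∑ l ∈ Finset.Ico (b * 2 ^ (k + 1)) ((b + 1) * 2 ^ (k + 1)), |x (l + 1) - x l| := by
  set T := ∑ l ∈ Finset.Ico (b * 2 ^ (k + 1)) ((b + 1) * 2 ^ (k + 1)), |x (l + 1) - x l|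
  have hs : 0 < √(2 : ℝ) := by positivity
  have h2 : √(2 : ℝ) * √2 = 2 := Real.mul_self_sqrt (by norm_num)
  have hT : ∀ i, b * 2 ^ (k + 1) ≤ i → i < (b + 1) * 2 ^ (k + 1) →
      |x i - x (b * 2 ^ (k + 1))| ≤ T := fun i h1 h2 =>
    (abs_sub_le_sum_Ico x h1).trans <| Finset.sum_le_sum_of_subset_of_nonneg
      (Finset.Ico_subset_Ico_right h2.le) fun _ _ _ => abs_nonneg _
  have hA := abs_scalingCoeff_sub_le k (2 * b) fun i h1 h2 => hT i (by rw [pow_succ]; linarith)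
      (by rw [pow_succ]; nlinarith [Nat.one_le_two_pow (n := k)])
  have hB := abs_scalingCoeff_sub_le k (2 * b + 1) fun i h1 h2 => hT i
      (by rw [pow_succ]; nlinarith [Nat.one_le_two_pow (n := k)]) (by rw [pow_succ]; linarith)
  rw [haarCoeff, abs_div, abs_of_pos hs, div_le_iff₀ hs]
  have h := abs_sub_le (scalingCoeff x k (2 * b)) (√2 ^ k * x (b * 2 ^ (k + 1)))
    (scalingCoeff x k (2 * b + 1))
  rw [abs_sub_comm (√2 ^ k * x (b * 2 ^ (k + 1)))] at h
  rw [pow_succ]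
  linear_combination h + hA + hB - (√2 ^ k) * T * h2

theorem sum_range_sum_Ico_mul (f : ℕ → ℝ) (m n : ℕ) :
    ∑ b ∈ Finset.range n, ∑ l ∈ Finset.Ico (b * m) ((b + 1) * m), f l
      = ∑ l ∈ Finset.range (n * m), f l := by
  induction n with
  | zero => simp
  | succ n ih =>
    rw [Finset.sum_range_succ, ih, Finset.range_eq_Ico, Finset.range_eq_Ico]
    exact Finset.sum_Ico_consecutive _ (Nat.zero_le _) (Nat.mul_le_mul_right m n.le_succ)

theorem sum_abs_haarCoeff_le {x : ℕ → ℝ} {V : ℝ}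
    (hV : ∀ N, ∑ i ∈ Finset.range N, |x (i + 1) - x i| ≤ V) (k n : ℕ) :
    ∑ b ∈ Finset.range n, |haarCoeff x k b| ≤ √2 ^ (k + 1) * V := by
  refine (Finset.sum_le_sum fun b _ => abs_haarCoeff_le x k b).trans ?_
  rw [← Finset.mul_sum, sum_range_sum_Ico_mul]
  exact mul_le_mul_of_nonneg_left (hV _) (by positivity)

theorem sum_sqrt_two_pow_le (K : ℕ) :
    ∑ k ∈ Finset.range K, √(2 : ℝ) ^ (k + 1) ≤ 4 * √2 ^ K := by
  have h1 : (1.4 : ℝ) ≤ √2 := Real.le_sqrt_of_sq_le (by norm_num)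
  induction K with
  | zero => simp
  | succ K ih =>
    rw [Finset.sum_range_succ, pow_succ]
    nlinarith [pow_pos (show 0 < √(2 : ℝ) by positivity) K]

theorem sum_mul_sqrt_two_pow_le (K : ℕ) :
    ∑ k ∈ Finset.range K, ((K : ℝ) - k) * √2 ^ (k + 1) ≤ 20 * √2 ^ K := by
  have h1 : (1.4 : ℝ) ≤ √2 := Real.le_sqrt_of_sq_le (by norm_num)
  have h3 : √(2 : ℝ) ≤ 1.5 := Real.sqrt_le_iff.2 (by norm_num)
  induction K with
  | zero => simp
  | succ K ih =>
    have h := sum_sqrt_two_pow_le (K + 1)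
    have e : ∑ k ∈ Finset.range (K + 1), (((K + 1 : ℕ) : ℝ) - k) * √2 ^ (k + 1)
        = ∑ k ∈ Finset.range K, ((K : ℝ) - k) * √2 ^ (k + 1)
          + ∑ k ∈ Finset.range (K + 1), √(2 : ℝ) ^ (k + 1) := by
      rw [Finset.sum_range_succ, Finset.sum_range_succ _ K, ← add_assoc, ← Finset.sum_add_distrib]
      congr 1
      · exact Finset.sum_congr rfl fun k _ => by push_cast; ring
      · push_cast; ring
    rw [e]
    rw [pow_succ] at h ⊢
    nlinarith [pow_pos (show 0 < √(2 : ℝ) by positivity) K]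

/-- The energy that is left in the noise `x` after its Haar coefficients below the level `K` have
been soft-thresholded, at a threshold that grows linearly with the depth below `K`. -/
noncomputable def residualEnergy (n K : ℕ) (x : ℕ → ℝ) : ℝ :=
  ∑ b ∈ Finset.range n, scalingCoeff x K b ^ 2
    + ∑ k ∈ Finset.range K, ∑ b ∈ Finset.range n, max (|haarCoeff x k b| - ((K : ℝ) - k)) 0 ^ 2

/-- The truncated part of each noise coefficient is paid for by the absolute sum of the Haar
coefficients of `y`, the excess by `p * q ≤ p ^ 2 + q ^ 2 / 4`. Parseval for `y` gathers the
quarters of all levels into a quarter of its energy. -/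
theorem sum_mul_le_residualEnergy {x y : ℕ → ℝ} {n : ℕ} {V : ℝ} (hx : ∀ i, n ≤ i → x i = 0)
    (hy : ∀ i, n ≤ i → y i = 0) (hV : ∀ N, ∑ i ∈ Finset.range N, |y (i + 1) - y i| ≤ V) (K : ℕ) :
    ∑ i ∈ Finset.range n, x i * y i
      ≤ (∑ k ∈ Finset.range K, ((K : ℝ) - k) * √2 ^ (k + 1)) * V + residualEnergy n K x
        + 1 / 4 * ∑ i ∈ Finset.range n, y i * y i := by
  rw [sum_mul_eq_haar hx y K, sum_mul_eq_haar hy y K, residualEnergy]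
  have h1 : ∑ b ∈ Finset.range n, scalingCoeff x K b * scalingCoeff y K b
      ≤ ∑ b ∈ Finset.range n, scalingCoeff x K b ^ 2
        + 1 / 4 * ∑ b ∈ Finset.range n, scalingCoeff y K b * scalingCoeff y K b := by
    rw [Finset.mul_sum, ← Finset.sum_add_distrib]
    refine Finset.sum_le_sum fun b _ => ?_
    nlinarith [sq_nonneg (scalingCoeff x K b - 1 / 2 * scalingCoeff y K b)]
  have h2 : ∑ k ∈ Finset.range K, ∑ b ∈ Finset.range n, haarCoeff x k b * haarCoeff y k b
      ≤ (∑ k ∈ Finset.range K, ((K : ℝ) - k) * √2 ^ (k + 1)) * V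
        + ∑ k ∈ Finset.range K, ∑ b ∈ Finset.range n,
            max (|haarCoeff x k b| - ((K : ℝ) - k)) 0 ^ 2
        + 1 / 4 * ∑ k ∈ Finset.range K, ∑ b ∈ Finset.range n, haarCoeff y k b * haarCoeff y k b := by
    rw [Finset.mul_sum, Finset.sum_mul, ← Finset.sum_add_distrib, ← Finset.sum_add_distrib]
    refine Finset.sum_le_sum fun k hk => ?_
    have ha : (0 : ℝ) ≤ (K : ℝ) - k := by
      rw [sub_nonneg]; exact_mod_cast (Finset.mem_range.1 hk).le
    have hT := mul_le_mul_of_nonneg_left (sum_abs_haarCoeff_le hV k n) ha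
    rw [← mul_assoc, Finset.mul_sum] at hT
    refine le_trans ?_ (add_le_add_left (add_le_add_left hT _) _)
    rw [Finset.mul_sum, ← Finset.sum_add_distrib, ← Finset.sum_add_distrib]
    refine Finset.sum_le_sum fun b _ => ?_
    set g := haarCoeff x k b
    set h := haarCoeff y k b
    set a := (K : ℝ) - k
    have h3 : g * h ≤ |g| * |h| := by rw [← abs_mul]; exact le_abs_self _
    have h4 : |g| ≤ a + max (|g| - a) 0 := by linarith [le_max_left (|g| - a) 0]
    have h5 := mul_le_mul_of_nonneg_right h4 (abs_nonneg h)
    nlinarith [sq_nonneg (max (|g| - a) 0 - 1 / 2 * |h|), abs_mul_abs_self h]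
  linarith

/-- A vector extended by zero to a sequence. -/
def zeroExtend {n : ℕ} (d : Fin n → ℝ) (i : ℕ) : ℝ := if h : i < n then d ⟨i, h⟩ else 0

theorem zeroExtend_of_le {n : ℕ} (d : Fin n → ℝ) (i : ℕ) (h : n ≤ i) : zeroExtend d i = 0 :=
  dif_neg h.not_gt

theorem zeroExtend_fin {n : ℕ} (d : Fin n → ℝ) (i : Fin n) : zeroExtend d i = d i :=
  dif_pos i.2

theorem sum_range_zeroExtend_sub {n : ℕ} (d : Fin n → ℝ) :
    ∑ i ∈ Finset.range (n - 1), |zeroExtend d (i + 1) - zeroExtend d i| = chainTV d := by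
  rw [Finset.sum_range, chainTV]
  refine Finset.sum_congr rfl fun i _ => ?_
  rw [zeroExtend, zeroExtend, dif_pos, dif_pos]

theorem chainTV_nonneg {n : ℕ} (d : Fin n → ℝ) : 0 ≤ chainTV d :=
  Finset.sum_nonneg fun _ _ => abs_nonneg _

/-- Extension by zero adds to the total variation the last entry, which is at most the total
variation plus the root mean square. -/
theorem sum_abs_zeroExtend_sub_le {n : ℕ} (hn : 1 ≤ n) (d : Fin n → ℝ) (N : ℕ) :
    ∑ i ∈ Finset.range N, |zeroExtend d (i + 1) - zeroExtend d i|
      ≤ 2 * chainTV d + √((∑ i, d i ^ 2) / n) := by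
  obtain ⟨m, rfl⟩ : ∃ m, n = m + 1 := ⟨n - 1, by omega⟩
  have hsum := sum_range_zeroExtend_sub d
  rw [Nat.add_sub_cancel] at hsum
  have hle : ∑ i ∈ Finset.range N, |zeroExtend d (i + 1) - zeroExtend d i|
      ≤ ∑ i ∈ Finset.range (m + 1), |zeroExtend d (i + 1) - zeroExtend d i| := by
    rw [← Finset.eventually_constant_sum (N := m + 1) (fun i hi => ?_) (Nat.le_add_right _ N)]
    · exact Finset.sum_le_sum_of_subset_of_nonneg (Finset.range_mono (Nat.le_add_left _ _))
        fun _ _ _ => abs_nonneg _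
    · rw [zeroExtend_of_le d i hi, zeroExtend_of_le d (i + 1) (by omega), sub_zero, abs_zero]
  refine hle.trans ?_
  rw [Finset.sum_range_succ, hsum, zeroExtend_of_le d (m + 1) le_rfl, zero_sub, abs_neg]
  set z := |zeroExtend d m|
  -- No entry differs from the last one by more than the total variation; so if the last is large,
  -- all are, and the root mean square is too.
  have hz : ∀ i : Fin (m + 1), z - chainTV d ≤ |d i| := by
    intro i
    have h1 := abs_sub_le_sum_Ico (zeroExtend d) (show (i : ℕ) ≤ m by omega)
    have h2 : ∑ l ∈ Finset.Ico (i : ℕ) m, |zeroExtend d (l + 1) - zeroExtend d l| ≤ chainTV d := by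
      rw [← hsum, Finset.range_eq_Ico]
      exact Finset.sum_le_sum_of_subset_of_nonneg (Finset.Ico_subset_Ico_left (Nat.zero_le _))
        fun _ _ _ => abs_nonneg _
    rw [zeroExtend_fin] at h1
    linarith [abs_sub_abs_le_abs_sub (zeroExtend d m) (d i)]
  suffices z - chainTV d ≤ √((∑ i, d i ^ 2) / ((m + 1 : ℕ) : ℝ)) by linarith
  rcases le_total z (chainTV d) with h | h
  · exact (sub_nonpos.2 h).trans (Real.sqrt_nonneg _)
  · refine Real.le_sqrt_of_sq_le ?_
    rw [le_div_iff₀ (by positivity), mul_comm, ← nsmul_eq_mul]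
    have h2 := Finset.card_nsmul_le_sum Finset.univ (fun i => d i ^ 2) ((z - chainTV d) ^ 2)
      fun i _ => by
        rw [← sq_abs (d i)]
        exact pow_le_pow_left₀ (sub_nonneg.2 h) (hz i) 2
    simpa using h2

/-- The dyadic level that matches the tuning parameter `lam`. -/
theorem exists_level (lam : ℝ≥0) :
    ∃ K : ℕ, ∑ k ∈ Finset.range K, ((K : ℝ) - k) * √2 ^ (k + 1) ≤ lam / 2 ∧
      (lam : ℝ) ^ 2 ≤ 3200 * 2 ^ K := by
  have hl := lam.coe_nonneg
  rcases le_total ((lam : ℝ) ^ 2) 1600 with h | h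
  · exact ⟨0, by simp; positivity, by simpa using h.trans (by norm_num)⟩
  -- This gives `1600 * 2 ^ K ≤ lam ^ 2 < 3200 * 2 ^ K`, where `1600 = (2 * 20) ^ 2` turns `20 * √2
  -- ^ K` into at most `lam / 2`.
  · obtain ⟨K, h1, h2⟩ := exists_nat_pow_near (x := (lam : ℝ) ^ 2 / 1600) (y := 2)
      (by rw [le_div_iff₀ (by norm_num)]; linarith) (by norm_num)
    refine ⟨K, (sum_mul_sqrt_two_pow_le K).trans ?_, ?_⟩
    · refine le_of_sq_le_sq ?_ (by positivity)
      have e : (20 * √2 ^ K) ^ 2 = 400 * (2 : ℝ) ^ K := by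
        rw [mul_pow, ← pow_mul, mul_comm K 2, pow_mul, Real.sq_sqrt (by norm_num)]
        norm_num
      rw [e]
      rw [le_div_iff₀ (by norm_num)] at h1
      linarith
    · rw [div_lt_iff₀ (by norm_num), pow_succ 2 K] at h2
      linarith

theorem chainTV_sub_le {n : ℕ} (x y : Fin n → ℝ) :
    chainTV (fun i => x i - y i) ≤ chainTV x + chainTV y := by
  unfold chainTV
  rw [← Finset.sum_add_distrib]
  refine Finset.sum_le_sum fun i _ => ?_
  rw [sub_sub_sub_comm]
  exact abs_sub _ _

theorem fusedLasso_le {n : ℕ} (lam : ℝ≥0) (y θ : Fin n → ℝ) :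
    fusedLassoObjective lam y (fusedLasso lam y) ≤ fusedLassoObjective lam y θ :=
  (existsUnique_fusedLasso lam y).choose_spec.1 θ

/-- The deterministic error bound for the 1d fused lasso. -/
theorem sum_sq_fusedLasso_sub_le {n K : ℕ} (hn : 1 ≤ n) {lam : ℝ≥0}
    (hK : ∑ k ∈ Finset.range K, ((K : ℝ) - k) * √2 ^ (k + 1) ≤ lam / 2) (θ e : Fin n → ℝ) :
    ∑ i, (fusedLasso lam (fun i => θ i + e i) i - θ i) ^ 2
      ≤ 16 * lam * chainTV θ + 4 * (lam : ℝ) ^ 2 / n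
        + 8 * residualEnergy n K (zeroExtend e) := by
  have hbasic := fusedLasso_le lam (fun i => θ i + e i) θ
  set est := fusedLasso lam (fun i => θ i + e i)
  set d : Fin n → ℝ := fun i => est i - θ i
  set D := ∑ i, d i ^ 2
  have hD : 0 ≤ D := Finset.sum_nonneg fun i _ => sq_nonneg _
  have hl := lam.coe_nonneg
  have hn' : (0 : ℝ) < n := by exact_mod_cast hn
  have hpair := sum_mul_le_residualEnergy (zeroExtend_of_le e) (zeroExtend_of_le d)
    (sum_abs_zeroExtend_sub_le hn d) K
  simp only [Finset.sum_range, zeroExtend_fin] at hpair hK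
  have hdd : ∑ i, d i * d i = D := Finset.sum_congr rfl fun i _ => (sq _).symm
  rw [hdd] at hpair
  set S := √(D / n)
  have hS : S ^ 2 = D / n := Real.sq_sqrt (by positivity)
  have hTVd : chainTV d ≤ chainTV est + chainTV θ := chainTV_sub_le est θ
  have hV : 0 ≤ 2 * chainTV d + S := by
    have := chainTV_nonneg d
    positivity
  -- Here `lam / 2` meets `2 * chainTV d`, so the share of the estimate is exactly `lam * chainTV
  -- est`, which the penalty cancels.
  have h1 := mul_le_mul_of_nonneg_right hK hV
  -- Of the `D / 2` in the optimality inequality the pairing uses `D / 4` and this term `D / 8`; the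
  -- remaining `D / 8` explains the factor 8 in the final bound.
  have h2 : lam / 2 * S ≤ D / 8 + (lam : ℝ) ^ 2 / (2 * n) := by
    have e1 : D = n * S ^ 2 := by rw [hS]; field_simp
    rw [e1, div_add_div _ _ (by norm_num) (by positivity), le_div_iff₀ (by positivity)]
    nlinarith [sq_nonneg ((n : ℝ) * S - 2 * lam)]
  have h3 := mul_le_mul_of_nonneg_left hTVd hl
  have hexp : ∑ i, ((θ i + e i) - est i) ^ 2 = ∑ i, e i ^ 2 - 2 * ∑ i, e i * d i + D := by
    rw [Finset.mul_sum, ← Finset.sum_sub_distrib, ← Finset.sum_add_distrib]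
    exact Finset.sum_congr rfl fun i _ => by simp only [d]; ring
  have hexp' : ∑ i, ((θ i + e i) - θ i) ^ 2 = ∑ i, e i ^ 2 :=
    Finset.sum_congr rfl fun i _ => by ring
  unfold fusedLassoObjective at hbasic
  rw [hexp, hexp'] at hbasic
  have h4 : (lam : ℝ) ^ 2 / (2 * n) = (4 * (lam : ℝ) ^ 2 / n) / 8 := by field_simp; ring
  rw [h4] at h2
  linarith

/-! ### Moments of the residual energy of sub-Gaussian noise -/

theorem exp_two_mul_abs_le_tsum (x : ℝ) :
    ENNReal.ofReal (Real.exp (2 * |x|)) ≤ 1 + ∑' k : ℕ,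
      ENNReal.ofReal (Real.exp (2 * (k + 1))) * ({z : ℝ | (k : ℝ) < |z|}.indicator 1 x) := by
  rcases eq_or_ne x 0 with rfl | hx
  · simp
  · have hpos : 0 < |x| := abs_pos.2 hx
    obtain ⟨k, hk⟩ : ∃ k, ⌈|x|⌉₊ = k + 1 :=
      Nat.exists_eq_succ_of_ne_zero (Nat.ceil_pos.2 hpos).ne'
    have h1 : (k : ℝ) < |x| := Nat.lt_ceil.1 (by omega)
    have h2 : |x| ≤ k + 1 := by
      have := Nat.le_ceil |x|
      rw [hk] at this
      exact_mod_cast this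
    refine le_trans ?_ ((ENNReal.le_tsum k).trans le_add_self)
    have h3 : x ∈ {z : ℝ | (k : ℝ) < |z|} := h1
    rw [Set.indicator_of_mem h3, Pi.one_apply, mul_one]
    gcongr

/-- A bound for `E exp (2 |X|)` when `X` is sub-Gaussian with constants `M` and `σ`. -/
noncomputable def expMomentBound (M σ : ℝ) : ℝ :=
  1 + ∑' k : ℕ, Real.exp (2 * (k + 1)) * (M * Real.exp (-(k : ℝ) ^ 2 / (2 * σ ^ 2)))

/-- Completing the square gives `3 * k ≤ k ^ 2 / (2 * σ ^ 2) + 9 * σ ^ 2 / 2`, which leaves a factor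
`exp (-k)`. -/
theorem summable_expMomentBound {M σ : ℝ} (hM : 0 < M) (hσ : 0 < σ) :
    Summable fun k : ℕ =>
      Real.exp (2 * (k + 1)) * (M * Real.exp (-(k : ℝ) ^ 2 / (2 * σ ^ 2))) := by
  refine Summable.of_nonneg_of_le (fun k => by positivity) (fun k => ?_)
    (Real.summable_exp_neg_nat.mul_left (M * Real.exp (2 + 9 * σ ^ 2 / 2)))
  rw [mul_left_comm, mul_assoc, ← Real.exp_add, ← Real.exp_add]
  refine mul_le_mul_of_nonneg_left (Real.exp_le_exp.2 ?_) hM.le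
  have : -(k : ℝ) ^ 2 / (2 * σ ^ 2) + 3 * k - 9 * σ ^ 2 / 2
      = -((k - 3 * σ ^ 2) ^ 2 / (2 * σ ^ 2)) := by
    field_simp
    ring
  have h2 : 0 ≤ ((k : ℝ) - 3 * σ ^ 2) ^ 2 / (2 * σ ^ 2) := by positivity
  linarith

theorem expMomentBound_nonneg {M : ℝ} (hM : 0 < M) (σ : ℝ) : 0 ≤ expMomentBound M σ :=
  add_nonneg zero_le_one (tsum_nonneg fun k => by positivity)

section Noise

variable {Ω : Type*} [MeasurableSpace Ω] {μ : Measure Ω} [IsProbabilityMeasure μ] {M σ : ℝ}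

theorem lintegral_exp_two_mul_abs_le {X : Ω → ℝ} (hM : 0 < M) (hσ : 0 < σ) (hX : Measurable X)
    (htail : ∀ s : ℝ, 0 ≤ s →
      μ.real {ω | s < |X ω|} ≤ M * Real.exp (-s ^ 2 / (2 * σ ^ 2))) :
    ∫⁻ ω, ENNReal.ofReal (Real.exp (2 * |X ω|)) ∂μ ≤ ENNReal.ofReal (expMomentBound M σ) := by
  have hset : ∀ k : ℕ, MeasurableSet {z : ℝ | (k : ℝ) < |z|} := fun k =>
    measurableSet_lt measurable_const measurable_id.abs
  refine (lintegral_mono fun ω => exp_two_mul_abs_le_tsum (X ω)).trans ?_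
  rw [lintegral_add_left measurable_const, lintegral_const, measure_univ, one_mul,
    lintegral_tsum fun k => by
      exact ((measurable_one.indicator (hset k)).comp hX).const_mul _ |>.aemeasurable,
    expMomentBound, ENNReal.ofReal_add zero_le_one (tsum_nonneg fun k => by positivity),
    ENNReal.ofReal_one, ENNReal.ofReal_tsum_of_nonneg (fun k => by positivity)
      (summable_expMomentBound hM hσ)]
  gcongr with k
  have hk : MeasurableSet {ω | (k : ℝ) < |X ω|} := hX (hset k)
  have hind : ∀ ω, {z : ℝ | (k : ℝ) < |z|}.indicator (1 : ℝ → ENNReal) (X ω)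
      = {ω | (k : ℝ) < |X ω|}.indicator 1 ω := fun ω => rfl
  simp only [hind]
  rw [lintegral_const_mul _ (measurable_one.indicator hk), lintegral_indicator_one hk,
    ENNReal.ofReal_mul (by positivity)]
  gcongr
  rw [← ofReal_measureReal]
  exact ENNReal.ofReal_le_ofReal (htail k k.cast_nonneg)

theorem integrable_exp_two_mul_abs {X : Ω → ℝ} (hM : 0 < M) (hσ : 0 < σ) (hX : Measurable X)
    (htail : ∀ s : ℝ, 0 ≤ s →
      μ.real {ω | s < |X ω|} ≤ M * Real.exp (-s ^ 2 / (2 * σ ^ 2))) :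
    Integrable (fun ω => Real.exp (2 * |X ω|)) μ ∧
      ∫ ω, Real.exp (2 * |X ω|) ∂μ ≤ expMomentBound M σ := by
  have h := lintegral_exp_two_mul_abs_le hM hσ hX htail
  have hm : Measurable fun ω => Real.exp (2 * |X ω|) := by fun_prop
  have hi : Integrable (fun ω => Real.exp (2 * |X ω|)) μ := by
    refine ⟨hm.aestronglyMeasurable, ?_⟩
    rw [hasFiniteIntegral_iff_ofReal (ae_of_all _ fun ω => (Real.exp_pos _).le)]
    exact h.trans_lt ENNReal.ofReal_lt_top
  refine ⟨hi, ?_⟩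
  rw [integral_eq_lintegral_of_nonneg_ae (ae_of_all _ fun ω => (Real.exp_pos _).le)
    hm.aestronglyMeasurable]
  exact ENNReal.toReal_le_of_le_ofReal (expMomentBound_nonneg hM σ) h

theorem sq_le_two_mul_exp_abs (x : ℝ) : x ^ 2 ≤ 2 * Real.exp |x| := by
  have := Real.quadratic_le_exp_of_nonneg (abs_nonneg x)
  rw [sq_abs] at this
  linarith [abs_nonneg x]

theorem exp_le_one_add_add_sq_mul (x : ℝ) :
    Real.exp x ≤ 1 + x + x ^ 2 * Real.exp |x| := by
  have h := Complex.norm_exp_sub_sum_le_norm_mul_exp (x : ℂ) 2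
  have e : Complex.exp x - ∑ m ∈ Finset.range 2, (x : ℂ) ^ m / (m.factorial : ℂ)
      = ((Real.exp x - (1 + x) : ℝ) : ℂ) := by
    simp [Finset.sum_range_succ]
  rw [e, Complex.norm_real, Complex.norm_real, Real.norm_eq_abs, Real.norm_eq_abs, sq_abs] at h
  linarith [le_abs_self (Real.exp x - (1 + x))]

/-- The mean-zero condition removes the linear term. For `|c| ≤ 1` the remainder is at most `2 * c ^
2 * exp (2 * |X|)`, which is why the exponential moment is taken at 2. -/
theorem mgf_le_exp_sq {X : Ω → ℝ} (hM : 0 < M) (hσ : 0 < σ) (hX : Measurable X)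
    (hmean : ∫ ω, X ω ∂μ = 0)
    (htail : ∀ s : ℝ, 0 ≤ s →
      μ.real {ω | s < |X ω|} ≤ M * Real.exp (-s ^ 2 / (2 * σ ^ 2))) {c : ℝ} (hc : |c| ≤ 1) :
    Integrable (fun ω => Real.exp (c * X ω)) μ ∧
      mgf X μ c ≤ Real.exp (2 * expMomentBound M σ * c ^ 2) := by
  obtain ⟨hi, hle⟩ := integrable_exp_two_mul_abs hM hσ hX htail
  have hcX : ∀ ω, |c * X ω| ≤ |X ω| := fun ω => by
    rw [abs_mul]
    exact mul_le_of_le_one_left (abs_nonneg _) hc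
  have hiX : Integrable X μ := by
    refine hi.mono' hX.aestronglyMeasurable (ae_of_all _ fun ω => ?_)
    rw [Real.norm_eq_abs]
    linarith [Real.add_one_le_exp (2 * |X ω|), abs_nonneg (X ω)]
  have hiexp : Integrable (fun ω => Real.exp (c * X ω)) μ := by
    refine hi.mono' (by fun_prop) (ae_of_all _ fun ω => ?_)
    rw [Real.norm_eq_abs, Real.abs_exp]
    exact Real.exp_le_exp.2 (by linarith [le_abs_self (c * X ω), hcX ω, abs_nonneg (X ω)])
  refine ⟨hiexp, ?_⟩
  have hpt : ∀ ω, Real.exp (c * X ω) ≤ 1 + c * X ω + 2 * c ^ 2 * Real.exp (2 * |X ω|) := by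
    intro ω
    refine (exp_le_one_add_add_sq_mul _).trans (add_le_add_right ?_ _)
    calc (c * X ω) ^ 2 * Real.exp |c * X ω|
        ≤ c ^ 2 * (2 * Real.exp |X ω|) * Real.exp |X ω| := by
          rw [mul_pow]
          exact mul_le_mul (mul_le_mul_of_nonneg_left (sq_le_two_mul_exp_abs _) (sq_nonneg c))
            (Real.exp_le_exp.2 (hcX ω)) (Real.exp_pos _).le (by positivity)
      _ = 2 * c ^ 2 * Real.exp (2 * |X ω|) := by rw [two_mul |X ω|, Real.exp_add]; ring
  calc mgf X μ c ≤ ∫ ω, (1 + c * X ω + 2 * c ^ 2 * Real.exp (2 * |X ω|)) ∂μ :=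
        integral_mono hiexp
          (((integrable_const _).add (hiX.const_mul c)).add (hi.const_mul _)) hpt
    _ = 1 + 2 * c ^ 2 * ∫ ω, Real.exp (2 * |X ω|) ∂μ := by
        rw [integral_add (f := fun ω => 1 + c * X ω)
          ((integrable_const _).add (hiX.const_mul c)) (hi.const_mul _),
          integral_add (integrable_const _) (hiX.const_mul c), integral_const_mul,
          integral_const_mul, hmean]
        simp
    _ ≤ 1 + 2 * c ^ 2 * expMomentBound M σ := by gcongr
    _ ≤ _ := by
        rw [show 2 * expMomentBound M σ * c ^ 2 = 2 * c ^ 2 * expMomentBound M σ by ring, add_comm]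
        exact Real.add_one_le_exp _

variable {n : ℕ} {ε : Fin n → Ω → ℝ}

theorem IsSubGaussianNoise.integral_exp_sum_le (hε : IsSubGaussianNoise μ ε M σ) (hM : 0 < M)
    (hσ : 0 < σ) {c : Fin n → ℝ} (hc : ∑ i, c i ^ 2 ≤ 1) :
    Integrable (fun ω => Real.exp (∑ i, c i * ε i ω)) μ ∧
      ∫ ω, Real.exp (∑ i, c i * ε i ω) ∂μ ≤ Real.exp (2 * expMomentBound M σ) := by
  have hci : ∀ i, |c i| ≤ 1 := fun i => by
    rw [← sq_le_one_iff_abs_le_one]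
    exact (Finset.single_le_sum (f := fun i => c i ^ 2) (fun i _ => sq_nonneg _)
      (Finset.mem_univ i)).trans hc
  have hind : iIndepFun (fun i ω => c i * ε i ω) μ :=
    hε.indep.comp (fun i x => c i * x) fun i => measurable_const_mul _
  have hmeas : ∀ i, Measurable fun ω => c i * ε i ω := fun i => (hε.measurable i).const_mul _
  have hone : ∀ i, Integrable (fun ω => Real.exp (c i * ε i ω)) μ ∧
      mgf (ε i) μ (c i) ≤ Real.exp (2 * expMomentBound M σ * c i ^ 2) := fun i =>
    mgf_le_exp_sq hM hσ (hε.measurable i) (hε.mean_zero i) (hε.tail i) (hci i)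
  have hint := hind.integrable_exp_mul_sum (t := 1) (s := Finset.univ) hmeas fun i _ => by
    simpa using (hone i).1
  have hmgf := hind.mgf_sum (t := 1) hmeas Finset.univ
  simp only [mgf, one_mul, Finset.sum_apply] at hint hmgf
  refine ⟨hint, hmgf.trans_le ?_⟩
  calc ∏ i, ∫ ω, Real.exp (c i * ε i ω) ∂μ
      ≤ ∏ i, Real.exp (2 * expMomentBound M σ * c i ^ 2) :=
        Finset.prod_le_prod (fun i _ => integral_nonneg fun ω => (Real.exp_pos _).le)
          fun i _ => (hone i).2
    _ = Real.exp (2 * expMomentBound M σ * ∑ i, c i ^ 2) := by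
        rw [← Real.exp_sum, Finset.mul_sum]
    _ ≤ _ := by
        have := expMomentBound_nonneg hM σ
        exact Real.exp_le_exp.2 (mul_le_of_le_one_right (by positivity) hc)

theorem sq_max_abs_sub_le (s a : ℝ) :
    max (|s| - a) 0 ^ 2 ≤ 2 * Real.exp (-a) * (Real.exp s + Real.exp (-s)) := by
  have h1 : max (|s| - a) 0 ^ 2 ≤ 2 * Real.exp (|s| - a) := by
    rcases le_total (|s| - a) 0 with h | h
    · rw [max_eq_right h, zero_pow two_ne_zero]; positivity
    · rw [max_eq_left h]
      simpa [abs_of_nonneg h] using sq_le_two_mul_exp_abs (|s| - a)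
  refine h1.trans ?_
  rw [sub_eq_add_neg, add_comm, Real.exp_add, mul_assoc]
  gcongr
  rcases abs_choice s with h | h <;> rw [h]
  · linarith [Real.exp_pos (-s)]
  · linarith [Real.exp_pos s]

/-- Soft-thresholded unit-norm combinations of the noise have exponentially small energy. -/
theorem IsSubGaussianNoise.integral_sq_max_le (hε : IsSubGaussianNoise μ ε M σ) (hM : 0 < M)
    (hσ : 0 < σ) {c : Fin n → ℝ} (hc : ∑ i, c i ^ 2 ≤ 1) (a : ℝ) :
    Integrable (fun ω => max (|∑ i, c i * ε i ω| - a) 0 ^ 2) μ ∧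
      ∫ ω, max (|∑ i, c i * ε i ω| - a) 0 ^ 2 ∂μ
        ≤ 4 * Real.exp (2 * expMomentBound M σ) * Real.exp (-a) := by
  obtain ⟨h1, h1'⟩ := hε.integral_exp_sum_le hM hσ hc
  obtain ⟨h2, h2'⟩ := hε.integral_exp_sum_le hM hσ (c := fun i => -c i) (by simpa using hc)
  simp only [neg_mul, Finset.sum_neg_distrib] at h2 h2'
  have hmeas := hε.measurable
  have hi := (h1.add h2).const_mul (2 * Real.exp (-a))
  have hint : Integrable (fun ω => max (|∑ i, c i * ε i ω| - a) 0 ^ 2) μ := by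
    refine hi.mono' (by fun_prop) (ae_of_all _ fun ω => ?_)
    rw [Real.norm_eq_abs, abs_of_nonneg (sq_nonneg _)]
    exact sq_max_abs_sub_le _ _
  refine ⟨hint, (integral_mono hint hi fun ω => sq_max_abs_sub_le _ _).trans ?_⟩
  simp only [Pi.add_apply]
  rw [integral_const_mul, integral_add h1 h2]
  nlinarith [Real.exp_pos (-a)]

/-- A contractive linear functional is the inner product with a vector in the unit ball. -/
theorem exists_coeff_of_contractive {n : ℕ} (f : (Fin n → ℝ) →ₗ[ℝ] ℝ)
    (hf : ∀ x, f x ^ 2 ≤ ∑ i, x i ^ 2) :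
    ∃ c : Fin n → ℝ, ∑ i, c i ^ 2 ≤ 1 ∧ ∀ x, f x = ∑ i, c i * x i := by
  set c : Fin n → ℝ := fun i => f (Pi.single i 1)
  have hfc : ∀ x, f x = ∑ i, c i * x i := fun x => by
    rw [f.pi_apply_eq_sum_univ x]
    refine Finset.sum_congr rfl fun i _ => ?_
    rw [smul_eq_mul, mul_comm]
    congr 2
    ext j
    simp [Pi.single_apply, eq_comm]
  refine ⟨c, ?_, hfc⟩
  -- Testing `f` on its own coefficient vector gives `(∑ c i ^ 2) ^ 2 ≤ ∑ c i ^ 2`.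
  have h := hf c
  rw [hfc] at h
  simp only [← sq] at h
  by_contra! hcon
  nlinarith

theorem scalingCoeff_add_mul (a : ℝ) (x y : ℕ → ℝ) (k : ℕ) : ∀ b,
    scalingCoeff (fun i => a * x i + y i) k b = a * scalingCoeff x k b + scalingCoeff y k b := by
  induction k with
  | zero => intro b; rfl
  | succ k ih => intro b; simp only [scalingCoeff, ih]; ring

theorem zeroExtend_add_mul {n : ℕ} (a : ℝ) (x y : Fin n → ℝ) :
    zeroExtend (fun i => a * x i + y i) = fun i => a * zeroExtend x i + zeroExtend y i := by
  ext i
  unfold zeroExtend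
  split_ifs <;> simp

theorem sum_sq_coeff_eq {n : ℕ} (x : Fin n → ℝ) (K : ℕ) :
    ∑ i, x i ^ 2 = ∑ b ∈ Finset.range n, scalingCoeff (zeroExtend x) K b ^ 2
      + ∑ k ∈ Finset.range K, ∑ b ∈ Finset.range n, haarCoeff (zeroExtend x) k b ^ 2 := by
  have h := sum_mul_eq_haar (zeroExtend_of_le x) (zeroExtend x) K
  simp only [← sq] at h
  rw [← h, Finset.sum_range]
  simp only [zeroExtend_fin]

/-- The scaling coefficients of vectors are inner products with vectors in the unit ball. -/
theorem exists_coeff_scaling {n : ℕ} (k : ℕ) {b : ℕ} (hb : b < n) :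
    ∃ c : Fin n → ℝ, ∑ i, c i ^ 2 ≤ 1 ∧
      ∀ x, scalingCoeff (zeroExtend x) k b = ∑ i, c i * x i := by
  refine exists_coeff_of_contractive
    (IsLinearMap.mk' (fun x : Fin n → ℝ => scalingCoeff (zeroExtend x) k b) ⟨fun x y => ?_,
      fun a x => ?_⟩) fun x => ?_
  · have := scalingCoeff_add_mul 1 (zeroExtend x) (zeroExtend y) k b
    rw [← zeroExtend_add_mul] at this
    simp only [one_mul] at this
    exact this
  -- Writing `a * x` as `(a - 1) * x + x` lets the same identity give homogeneity.
  · have := scalingCoeff_add_mul (a - 1) (zeroExtend x) (zeroExtend x) k b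
    rw [← zeroExtend_add_mul] at this
    simp only [sub_mul, one_mul, sub_add_cancel] at this
    exact this
  · rw [sum_sq_coeff_eq x k]
    refine le_add_of_le_of_nonneg ?_
      (Finset.sum_nonneg fun _ _ => Finset.sum_nonneg fun _ _ => sq_nonneg _)
    exact Finset.single_le_sum (f := fun b => scalingCoeff (zeroExtend x) k b ^ 2)
      (fun _ _ => sq_nonneg _) (Finset.mem_range.2 hb)

/-- The Haar coefficients of vectors are inner products with vectors in the unit ball. -/
theorem exists_coeff_haar {n : ℕ} (k : ℕ) {b : ℕ} (hb : b < n) :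
    ∃ c : Fin n → ℝ, ∑ i, c i ^ 2 ≤ 1 ∧
      ∀ x, haarCoeff (zeroExtend x) k b = ∑ i, c i * x i := by
  refine exists_coeff_of_contractive
    (IsLinearMap.mk' (fun x : Fin n → ℝ => haarCoeff (zeroExtend x) k b) ⟨fun x y => ?_,
      fun a x => ?_⟩) fun x => ?_
  · have h1 := scalingCoeff_add_mul 1 (zeroExtend x) (zeroExtend y) k (2 * b)
    have h2 := scalingCoeff_add_mul 1 (zeroExtend x) (zeroExtend y) k (2 * b + 1)
    rw [← zeroExtend_add_mul] at h1 h2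
    simp only [one_mul] at h1 h2
    change (scalingCoeff (zeroExtend fun i => x i + y i) k (2 * b)
      - scalingCoeff (zeroExtend fun i => x i + y i) k (2 * b + 1)) / √2 = _
    rw [h1, h2, haarCoeff, haarCoeff]
    ring
  · have h1 := scalingCoeff_add_mul (a - 1) (zeroExtend x) (zeroExtend x) k (2 * b)
    have h2 := scalingCoeff_add_mul (a - 1) (zeroExtend x) (zeroExtend x) k (2 * b + 1)
    rw [← zeroExtend_add_mul] at h1 h2
    simp only [sub_mul, one_mul, sub_add_cancel] at h1 h2
    change (scalingCoeff (zeroExtend fun i => a * x i) k (2 * b)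
      - scalingCoeff (zeroExtend fun i => a * x i) k (2 * b + 1)) / √2
        = a * haarCoeff (zeroExtend x) k b
    rw [h1, h2, haarCoeff]
    ring
  · rw [sum_sq_coeff_eq x (k + 1), Finset.sum_range_succ]
    refine le_add_of_nonneg_of_le (Finset.sum_nonneg fun _ _ => sq_nonneg _)
      (le_add_of_nonneg_of_le
        (Finset.sum_nonneg fun _ _ => Finset.sum_nonneg fun _ _ => sq_nonneg _) ?_)
    exact Finset.single_le_sum (f := fun b => haarCoeff (zeroExtend x) k b ^ 2)
      (fun _ _ => sq_nonneg _) (Finset.mem_range.2 hb)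

/-- At most `n / 2 ^ k + 1` dyadic blocks of length `2 ^ k` meet `{0, …, n - 1}`. -/
theorem sum_range_le_of_blocks {n k : ℕ} {f : ℕ → ℝ} {B : ℝ} (hB : 0 ≤ B)
    (hf : ∀ b < n, f b ≤ B) (hf0 : ∀ b, n ≤ b * 2 ^ k → f b = 0) :
    ∑ b ∈ Finset.range n, f b ≤ ((n : ℝ) / 2 ^ k + 1) * B := by
  have hpos : 0 < 2 ^ k := by positivity
  calc ∑ b ∈ Finset.range n, f b
      ≤ ∑ b ∈ Finset.range n, if b < n / 2 ^ k + 1 then B else 0 := by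
        refine Finset.sum_le_sum fun b hb => ?_
        split_ifs with h
        · exact hf b (Finset.mem_range.1 hb)
        · refine (hf0 b ?_).le
          have h1 : n / 2 ^ k < b := by omega
          exact ((Nat.div_lt_iff_lt_mul hpos).1 h1).le
    _ ≤ ∑ b ∈ Finset.range (n / 2 ^ k + 1), B := by
        rw [← Finset.sum_filter]
        refine Finset.sum_le_sum_of_subset_of_nonneg (fun b hb => ?_) fun _ _ _ => hB
        simpa using (Finset.mem_filter.1 hb).2
    _ ≤ ((n : ℝ) / 2 ^ k + 1) * B := by
        rw [Finset.sum_const, Finset.card_range, nsmul_eq_mul]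
        push_cast
        gcongr
        exact_mod_cast (Nat.cast_div_le (α := ℝ) (m := n) (n := 2 ^ k))

theorem sum_range_pow_sub_le (K : ℕ) :
    ∑ k ∈ Finset.range K, (3 / 4 : ℝ) ^ (K - k) ≤ 3 := by
  induction K with
  | zero => simp
  | succ K ih =>
    have e : ∑ k ∈ Finset.range K, (3 / 4 : ℝ) ^ (K + 1 - k)
        = 3 / 4 * ∑ k ∈ Finset.range K, (3 / 4 : ℝ) ^ (K - k) := by
      rw [Finset.mul_sum]
      refine Finset.sum_congr rfl fun k hk => ?_
      rw [Nat.succ_sub (Finset.mem_range.1 hk).le, pow_succ, mul_comm]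
    rw [Finset.sum_range_succ, e, Nat.add_sub_cancel_left]
    linarith

/-- Going `j` levels down multiplies the block count by at most `2 ^ j` and the energy bound by `exp
(-j) ≤ (3 / 8) ^ j`. -/
theorem blocks_mul_exp_le (n : ℕ) {k K : ℕ} (hk : k ≤ K) :
    ((n : ℝ) / 2 ^ k + 1) * Real.exp (-((K : ℝ) - k))
      ≤ (n / 2 ^ K + 1) * (3 / 4) ^ (K - k) := by
  obtain ⟨j, rfl⟩ := Nat.exists_eq_add_of_le hk
  rw [Nat.add_sub_cancel_left]
  have h1 : (n : ℝ) / 2 ^ k + 1 ≤ (n / 2 ^ (k + j) + 1) * 2 ^ j := by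
    have : (n : ℝ) / 2 ^ k = n / 2 ^ (k + j) * 2 ^ j := by rw [pow_add]; field_simp
    rw [this, add_mul, one_mul]
    exact add_le_add_right (one_le_pow₀ one_le_two) _
  have h2 : Real.exp (-(((k + j : ℕ) : ℝ) - k)) ≤ (3 / 8) ^ j := by
    have e : -(((k + j : ℕ) : ℝ) - k) = (j : ℝ) * (-1) := by push_cast; ring
    rw [e, Real.exp_nat_mul]
    gcongr
    rw [Real.exp_neg, inv_le_comm₀ (Real.exp_pos _) (by norm_num)]
    linarith [Real.exp_one_gt_d9]
  calc ((n : ℝ) / 2 ^ k + 1) * Real.exp (-(((k + j : ℕ) : ℝ) - k))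
      ≤ (n / 2 ^ (k + j) + 1) * 2 ^ j * (3 / 8) ^ j := by gcongr
    _ = (n / 2 ^ (k + j) + 1) * (3 / 4) ^ j := by
        rw [mul_assoc, ← mul_pow]; norm_num

/-- The expected residual energy at level `K` is of the order of the number of blocks. -/
theorem IsSubGaussianNoise.integral_residualEnergy_le (hε : IsSubGaussianNoise μ ε M σ)
    (hM : 0 < M) (hσ : 0 < σ) (K : ℕ) :
    Integrable (fun ω => residualEnergy n K (zeroExtend fun i => ε i ω)) μ ∧
      ∫ ω, residualEnergy n K (zeroExtend fun i => ε i ω) ∂μ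
        ≤ 16 * Real.exp (2 * expMomentBound M σ) * (n / 2 ^ K + 1) := by
  set C := 4 * Real.exp (2 * expMomentBound M σ) with hC
  have hC0 : 0 ≤ C := by positivity
  have hscal : ∀ b < n,
      Integrable (fun ω => scalingCoeff (zeroExtend fun i => ε i ω) K b ^ 2) μ ∧
        ∫ ω, scalingCoeff (zeroExtend fun i => ε i ω) K b ^ 2 ∂μ ≤ C := fun b hb => by
    obtain ⟨c, hc, h⟩ := exists_coeff_scaling K hb
    -- Threshold zero recovers the plain square.
    have := hε.integral_sq_max_le hM hσ hc 0
    simpa [h, hC] using this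
  have hhaar : ∀ k, ∀ b < n, Integrable (fun ω =>
        max (|haarCoeff (zeroExtend fun i => ε i ω) k b| - ((K : ℝ) - k)) 0 ^ 2) μ ∧
      ∫ ω, max (|haarCoeff (zeroExtend fun i => ε i ω) k b| - ((K : ℝ) - k)) 0 ^ 2 ∂μ
        ≤ C * Real.exp (-((K : ℝ) - k)) := fun k b hb => by
    obtain ⟨c, hc, h⟩ := exists_coeff_haar k hb
    simp only [h]
    exact hε.integral_sq_max_le hM hσ hc _
  have i1 : Integrable (fun ω => ∑ b ∈ Finset.range n,
      scalingCoeff (zeroExtend fun i => ε i ω) K b ^ 2) μ :=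
    integrable_finsetSum _ fun b hb => (hscal b (Finset.mem_range.1 hb)).1
  have i2 : ∀ k, Integrable (fun ω => ∑ b ∈ Finset.range n,
      max (|haarCoeff (zeroExtend fun i => ε i ω) k b| - ((K : ℝ) - k)) 0 ^ 2) μ := fun k =>
    integrable_finsetSum _ fun b hb => (hhaar k b (Finset.mem_range.1 hb)).1
  have i3 : Integrable (fun ω => ∑ k ∈ Finset.range K, ∑ b ∈ Finset.range n,
      max (|haarCoeff (zeroExtend fun i => ε i ω) k b| - ((K : ℝ) - k)) 0 ^ 2) μ :=
    integrable_finsetSum _ fun k _ => i2 k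
  unfold residualEnergy
  refine ⟨i1.add i3, ?_⟩
  rw [integral_add i1 i3,
    integral_finsetSum _ fun b hb => (hscal b (Finset.mem_range.1 hb)).1,
    integral_finsetSum _ fun k _ => i2 k]
  have h1 : ∑ b ∈ Finset.range n, ∫ ω, scalingCoeff (zeroExtend fun i => ε i ω) K b ^ 2 ∂μ
      ≤ ((n : ℝ) / 2 ^ K + 1) * C :=
    sum_range_le_of_blocks hC0 (fun b hb => (hscal b hb).2) fun b hb => by
      simp [scalingCoeff_eq_zero (zeroExtend_of_le _) hb]
  have h2 : ∀ k ∈ Finset.range K, ∫ ω, ∑ b ∈ Finset.range n,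
      max (|haarCoeff (zeroExtend fun i => ε i ω) k b| - ((K : ℝ) - k)) 0 ^ 2 ∂μ
        ≤ ((n : ℝ) / 2 ^ K + 1) * C * (3 / 4) ^ (K - k) := by
    intro k hk
    have hkK : k ≤ K := (Finset.mem_range.1 hk).le
    have hk0 : (k : ℝ) ≤ K := by exact_mod_cast hkK
    rw [integral_finsetSum _ fun b hb => (hhaar k b (Finset.mem_range.1 hb)).1]
    have h := sum_range_le_of_blocks (n := n) (k := k) (B := C * Real.exp (-((K : ℝ) - k)))
      (by positivity) (fun b hb => (hhaar k b hb).2) fun b hb => by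
        simp [haarCoeff_eq_zero (zeroExtend_of_le _) hb, hk0]
    refine h.trans ?_
    calc ((n : ℝ) / 2 ^ k + 1) * (C * Real.exp (-((K : ℝ) - k)))
        = C * (((n : ℝ) / 2 ^ k + 1) * Real.exp (-((K : ℝ) - k))) := by ring
      _ ≤ C * ((n / 2 ^ K + 1) * (3 / 4) ^ (K - k)) := 
          mul_le_mul_of_nonneg_left (blocks_mul_exp_le n hkK) hC0
      _ = _ := by ring
  have h3 := Finset.sum_le_sum h2
  rw [← Finset.mul_sum] at h3
  have h4 := mul_le_mul_of_nonneg_left (sum_range_pow_sub_le K)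
    (show 0 ≤ ((n : ℝ) / 2 ^ K + 1) * C by positivity)
  calc _ ≤ ((n : ℝ) / 2 ^ K + 1) * C + ((n : ℝ) / 2 ^ K + 1) * C * 3 :=
        add_le_add h1 (h3.trans h4)
    _ = _ := by rw [hC]; ring

end Noise

/-! ### The rate of convergence -/

theorem IsSubGaussianNoise.comp_perm {Ω : Type*} [MeasurableSpace Ω] {μ : Measure Ω} {n : ℕ}
    {ε : Fin n → Ω → ℝ} {M σ : ℝ} (hε : IsSubGaussianNoise μ ε M σ) (τ : Equiv.Perm (Fin n)) :
    IsSubGaussianNoise μ (fun i => ε (τ i)) M σ where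
  measurable _ := hε.measurable _
  indep := hε.indep.precomp τ.injective
  identDistrib _ _ := hε.identDistrib _ _
  mean_zero _ := hε.mean_zero _
  tail _ := hε.tail _

theorem mse_dfsFusedLasso {n : ℕ} (lam : ℝ≥0) (τ : Equiv.Perm (Fin n)) (y θ : Fin n → ℝ) :
    mse (dfsFusedLasso lam τ y) θ
      = 1 / (n : ℝ) * ∑ i, (fusedLasso lam (fun i => y (τ i)) i - θ (τ i)) ^ 2 := by
  rw [mse, ← Equiv.sum_comp τ]
  simp [dfsFusedLasso]

/-- A nonasymptotic deviation bound for the 1d fused lasso. -/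
theorem IsSubGaussianNoise.measureReal_fusedLasso_le {Ω : Type*} [MeasurableSpace Ω]
    {μ : Measure Ω} [IsProbabilityMeasure μ] {n : ℕ} {ε : Fin n → Ω → ℝ} {M σ : ℝ}
    (hε : IsSubGaussianNoise μ ε M σ) (hM : 0 < M) (hσ : 0 < σ) (hn : 1 ≤ n) {lam : ℝ≥0}
    (hlam : 0 < lam) (θ : Fin n → ℝ) {x : ℝ} (hx : 0 < x) :
    μ.real {ω | 16 * lam * chainTV θ + 4 * (lam : ℝ) ^ 2 / n + 8 * x
        < ∑ i, (fusedLasso lam (fun i => θ i + ε i ω) i - θ i) ^ 2}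
      ≤ 16 * Real.exp (2 * expMomentBound M σ) * (3200 * (n / (lam : ℝ) ^ 2) + 1) / x := by
  obtain ⟨K, hK, hK'⟩ := exists_level lam
  obtain ⟨hint, hle⟩ := hε.integral_residualEnergy_le hM hσ K
  have hl : (0 : ℝ) < lam := by exact_mod_cast hlam
  have hmarkov := mul_meas_ge_le_integral_of_nonneg (μ := μ)
    (f := fun ω => residualEnergy n K (zeroExtend fun i => ε i ω))
    (ae_of_all _ fun ω => by unfold residualEnergy; positivity) hint x
  have hsub : {ω | 16 * lam * chainTV θ + 4 * (lam : ℝ) ^ 2 / n + 8 * x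
        < ∑ i, (fusedLasso lam (fun i => θ i + ε i ω) i - θ i) ^ 2}
      ⊆ {ω | x ≤ residualEnergy n K (zeroExtend fun i => ε i ω)} := by
    intro ω hω
    have h1 := sum_sq_fusedLasso_sub_le hn hK θ fun i => ε i ω
    rw [Set.mem_ofPred_eq] at hω ⊢
    linarith
  refine (measureReal_mono hsub).trans ?_
  rw [le_div_iff₀ hx, mul_comm]
  refine (hmarkov.trans hle).trans ?_
  gcongr
  rw [← mul_div_assoc, div_le_div_iff₀ (by positivity) (by positivity)]
  have hn0 : (0 : ℝ) ≤ n := n.cast_nonneg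
  linarith [mul_le_mul_of_nonneg_left hK' hn0]

theorem rpow_one_third_pow {a : ℝ} (ha : 0 ≤ a) : (a ^ (1 / 3 : ℝ)) ^ 3 = a := by
  rw [← Real.rpow_natCast, ← Real.rpow_mul ha]
  norm_num

theorem rpow_two_thirds {a : ℝ} (ha : 0 ≤ a) : a ^ (2 / 3 : ℝ) = (a ^ (1 / 3 : ℝ)) ^ 2 := by
  rw [← Real.rpow_natCast, ← Real.rpow_mul ha]
  norm_num

theorem theorem1
    {Ω : ℕ → Type*} [∀ n, MeasurableSpace (Ω n)]
    (μ : ∀ n, Measure (Ω n)) [∀ n, IsProbabilityMeasure (μ n)]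
    (M σ : ℝ) (hM : 0 < M) (hσ : 0 < σ)
    (ε : ∀ n, Fin n → Ω n → ℝ) (hε : ∀ n, IsSubGaussianNoise (μ n) (ε n) M σ)
    (G : ∀ n, SimpleGraph (Fin n)) (hG : ∀ n, 1 ≤ n → (G n).Connected)
    (t : ℕ → ℝ) (ht : ∀ n, 0 < t n)
    (ht_lower : (fun n : ℕ => (n : ℝ) ^ (-(1 / 2) : ℝ)) =O[atTop] t)
    (θ₀ : ∀ n, Fin n → ℝ) (hθ₀ : ∀ n, θ₀ n ∈ BVClass (G n) (t n))
    (τ : ∀ n, Equiv.Perm (Fin n)) (hτ : ∀ n, 1 ≤ n → IsDFSOrdering (G n) (τ n))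
    (lam : ℕ → ℝ≥0)
    (hlam : (fun n => (lam n : ℝ)) =Θ[atTop]
      fun n : ℕ => t n ^ (-(1 / 3) : ℝ) * (n : ℝ) ^ (1 / 3 : ℝ)) :
    IsBigOInProbability μ
      (fun n ω => mse (dfsFusedLasso (lam n) (τ n) (fun i => θ₀ n i + ε n i ω)) (θ₀ n))
      (fun n : ℕ => t n ^ (2 / 3 : ℝ) * (n : ℝ) ^ (-(2 / 3) : ℝ)) := by
  obtain ⟨A₀, hA₀⟩ := ht_lower.bound
  obtain ⟨C₂, hC₂, hup⟩ := hlam.isBigO.exists_pos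
  obtain ⟨C₁, hC₁, hlo⟩ := hlam.isBigO_symm.exists_pos
  set A := max A₀ 1
  -- Needed below for `A ^ 2 ≤ A ^ 3`.
  have hA1 : 1 ≤ A := le_max_right _ _
  set D := 16 * Real.exp (2 * expMomentBound M σ) * (3200 * C₁ ^ 2 + A) with hD
  have hD0 : 0 < D := by positivity
  intro δ hδ
  refine ⟨32 * C₂ + 4 * (C₂ ^ 2 * A ^ 2) + 8 * (D / δ), by positivity, ?_⟩
  filter_upwards [hA₀, hup.bound, hlo.bound, eventually_ge_atTop 1] with n hA₀ hup hlo hn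
  have hn0 : (0 : ℝ) < n := by exact_mod_cast hn
  have htn := ht n
  set u := t n ^ (1 / 3 : ℝ) with hu
  set v := (n : ℝ) ^ (1 / 3 : ℝ) with hv
  have hu0 : 0 < u := by positivity
  have hv0 : 0 < v := by positivity
  have hu3 : u ^ 3 = t n := rpow_one_third_pow htn.le
  have hv3 : v ^ 3 = n := rpow_one_third_pow hn0.le
  have hrate : t n ^ (2 / 3 : ℝ) * (n : ℝ) ^ (-(2 / 3) : ℝ) = 1 / n * (u ^ 2 * v) := by
    rw [Real.rpow_neg hn0.le, rpow_two_thirds htn.le, rpow_two_thirds hn0.le, ← hu, ← hv, ← hv3]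
    field_simp
  have hs : t n ^ (-(1 / 3) : ℝ) * v = v / u := by
    rw [Real.rpow_neg htn.le, ← hu, inv_mul_eq_div]
  have hlam0 := (lam n).coe_nonneg
  rw [hs, Real.norm_of_nonneg hlam0, Real.norm_of_nonneg (by positivity)] at hup hlo
  rw [Real.norm_of_nonneg (by positivity), Real.norm_of_nonneg htn.le] at hA₀
  have hlampos : (0 : ℝ) < lam n := by
    have : 0 < v / u := by positivity
    exact pos_of_mul_pos_right (this.trans_le hlo) hC₁.le
  -- `r` is `n` times the target rate, and every term of the deviation bound is compared with it.
  set r := u ^ 2 * v with hr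
  have hr0 : 0 < r := by positivity
  -- This is where the lower bound on `t` enters: `r ^ 3 = t ^ 2 * n` stays away from zero, so the
  -- terms `lam ^ 2 / n`, of order `1 / r`, and `1` are both of order at most `r`.
  have hAr : 1 ≤ A * r := by
    have h1 : (n : ℝ) ^ (-(1 / 2) : ℝ) ≤ A * t n :=
      hA₀.trans (mul_le_mul_of_nonneg_right (le_max_left _ _) htn.le)
    have h2 : ((n : ℝ) ^ (-(1 / 2) : ℝ)) ^ 2 = 1 / n := by
      rw [← Real.rpow_natCast, ← Real.rpow_mul hn0.le]
      norm_num [Real.rpow_neg_one]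
    have h3 := pow_le_pow_left₀ (by positivity) h1 2
    rw [h2, div_le_iff₀ hn0, ← hu3, ← hv3] at h3
    have h4 : 1 ≤ (A * r) ^ 3 := by
      refine h3.trans ?_
      have e : (A * r) ^ 3 = A * ((A * u ^ 3) ^ 2 * v ^ 3) := by rw [hr]; ring
      rw [e]
      exact le_mul_of_one_le_left (by positivity) hA1
    exact (one_le_pow_iff_of_nonneg (by positivity) three_ne_zero).1 h4
  have hTV : 16 * lam n * chainTV (fun i => θ₀ n (τ n i)) ≤ 32 * C₂ * r := by
    have h1 : chainTV (fun i => θ₀ n (τ n i)) ≤ 2 * u ^ 3 := by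
      rw [hu3]
      exact ((hτ n hn).chainTV_le _).trans (mul_le_mul_of_nonneg_left (hθ₀ n) zero_le_two)
    calc 16 * lam n * chainTV (fun i => θ₀ n (τ n i))
        ≤ 16 * (C₂ * (v / u)) * (2 * u ^ 3) := by
          have := chainTV_nonneg fun i => θ₀ n (τ n i)
          gcongr
      _ = 32 * C₂ * r := by rw [hr]; field_simp; ring
  have hbias : 4 * (lam n : ℝ) ^ 2 / n ≤ 4 * (C₂ ^ 2 * A ^ 2) * r := by
    calc 4 * (lam n : ℝ) ^ 2 / n ≤ 4 * (C₂ * (v / u)) ^ 2 / n := by gcongr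
      _ = 4 * C₂ ^ 2 * (1 ^ 2 / r) := by rw [hr, ← hv3]; field_simp
      _ ≤ 4 * C₂ ^ 2 * ((A * r) ^ 2 / r) := by gcongr
      _ = 4 * (C₂ ^ 2 * A ^ 2) * r := by field_simp
  have hvar : 16 * Real.exp (2 * expMomentBound M σ) * (3200 * (n / (lam n : ℝ) ^ 2) + 1)
      ≤ D * r := by
    have h1 : (n : ℝ) / (lam n : ℝ) ^ 2 ≤ C₁ ^ 2 * r := by
      rw [div_le_iff₀ (by positivity)]
      calc (n : ℝ) = (v / u) ^ 2 * r := by rw [hr, ← hv3]; field_simp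
        _ ≤ (C₁ * lam n) ^ 2 * r := by gcongr
        _ = _ := by ring
    rw [hD, mul_assoc, mul_assoc, mul_assoc]
    gcongr
    linarith
  -- The level `D * r / δ` makes Markov's bound equal to `δ`.
  have hdev := ((hε n).comp_perm (τ n)).measureReal_fusedLasso_le hM hσ hn
    (by exact_mod_cast hlampos) (fun i => θ₀ n (τ n i)) (x := D * r / δ) (by positivity)
  refine (measureReal_mono fun ω hω => ?_).trans (hdev.trans ?_)
  · rw [Set.mem_ofPred_eq, hrate, abs_of_nonneg (by positivity), mse_dfsFusedLasso,
      abs_of_nonneg (mul_nonneg (by positivity) (Finset.sum_nonneg fun _ _ => sq_nonneg _)),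
      mul_left_comm] at hω
    have h' := lt_of_mul_lt_mul_left hω (by positivity)
    refine lt_of_le_of_lt ?_ h'
    have e : 8 * (D * r / δ) = 8 * (D / δ) * r := by ring
    rw [e, add_mul, add_mul]
    linarith
  · rw [div_le_iff₀ (by positivity), mul_div_cancel₀ _ hδ.ne']
    exact hvar
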